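/- Conventions. A morphism of schemes is a \emph{universal homeomorphism} if each of its base changes is a homeomorphism on underlying topological spaces. A scheme $Y$ is \emph{topologically rigid} if every universal homeomorphism $Y'\to Y$ with $Y'$ reduced is an isomorphism. A scheme is \emph{coherent} if it is quasi-compact and quasi-separated. A \emph{topological rigidification} of a scheme $X$ is a morphism $\varepsilon\colon X_{\mathrm{trig}}\to X$ with $X_{\mathrm{trig}}$ topologically rigid such that every morphism $Z\to X$ from a topologically rigid scheme $Z$ factors uniquely through $\varepsilon$; it is the value at $X$, with its counit, of the right adjoint to the inclusion of topologically rigid schemes into schemes. For coherent $X$ there is also the version inside coherent schemes, in which $X_{\mathrm{trig}}$ and the test schemes $Z$ are required to be coherent; it is the value at $X$ of the right adjoint to the inclusion of coherent topologically rigid $X$-schemes into coherent $X$-schemes. For a morphism $f\colon Y\to X$, let $\mathrm{UH}_f$ be the category of factorizations $Y\to X'\to X$ of $f$ in which $X'\to X$ is a universal homeomorphism; the \emph{weak normalization of $X$ under $f$} is an initial object of $\mathrm{UH}_f$. Let $X$ be a reduced scheme whose set of irreducible components is locally finite. Let $X^{(0)}$ be the set of generic points of the irreducible components of $X$, put $$\Xi:=\coprod_{\eta\in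 X^{(0)}}\operatorname{Spec}\bigl(\kappa(\eta)^{\mathrm{perf}}\bigr),$$ where $\kappa(\eta)^{\mathrm{perf}}$ is the perfect closure of the residue field $\kappa(\eta)$, and let $\pi\colon\Xi\to X$ be the natural morphism. Then $\pi$ is dominant, the weak normalization of $X$ under $\pi$ exists, and it is the topological rigidification of $X$: a morphism $T\to X$ is a weak normalization of $X$ under $\pi$ (for some factorization of $\pi$ through $T$) if and only if it is a topological rigidification of $X$. If $X$ is coherent, the same holds for the topological rigidification formed inside coherent schemes; in particular, for any right adjoint of the inclusion of coherent topologically rigid $X$-schemes into coherent $X$-schemes, its counit at $X$ is the weak normalization of $X$ under $\pi$. -/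

import Mathlib

open CategoryTheory CategoryTheory.Limits AlgebraicGeometry

universe u

namespace TopRigid

noncomputable section

/-- A morphism of schemes is a universal homeomorphism if every base change of it is a
homeomorphism on underlying topological spaces. -/
def UniversalHomeo : MorphismProperty Scheme.{u} :=
  MorphismProperty.universally (topologically @IsHomeomorph)

/-- Coherent schemes: quasi-compact and quasi-separated. -/
def IsCoherent : ObjectProperty Scheme.{u} :=
  fun X => CompactSpace X ∧ QuasiSeparatedSpace X

/-- A scheme `Y` is topologically rigid if every universal homeomorphism `Y' ⟶ Y` with `Y'` reduced
is an isomorphism. (Coherence of `Y` is not part of this predicate; it is added where needed.) -/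
def IsTopologicallyRigid : ObjectProperty Scheme.{u} :=
  fun Y => ∀ (Y' : Scheme.{u}) (f : Y' ⟶ Y), IsReduced Y' → UniversalHomeo f → IsIso f

/-- `ε : T ⟶ X` exhibits `T` as the coreflection of `X` into the topologically rigid schemes that
belong to a class `P` of schemes: `T` is a topologically rigid member of `P`, and every morphism
to `X` from a topologically rigid member of `P` factors uniquely through `ε`. In other words,
`T` is the value at `X`, and `ε` the counit at `X`, of the right adjoint of the inclusion of the
topologically rigid members of `P`. With `P = ⊤` this concerns all schemes,
with `P = IsCoherent` the coherent ones. -/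
structure IsTopologicalRigidification (P : ObjectProperty Scheme.{u})
    {T X : Scheme.{u}} (ε : T ⟶ X) : Prop where
  mem : P T
  rigid : IsTopologicallyRigid T
  existsUnique_lift : ∀ (Z : Scheme.{u}), P Z → IsTopologicallyRigid Z →
    ∀ g : Z ⟶ X, ∃! h : Z ⟶ T, h ≫ ε = g

/-- The category of coherent `X`-schemes. -/
abbrev SchCoh (X : Scheme.{u}) :=
  ObjectProperty.FullSubcategory (fun Y : Over X => IsCoherent Y.left)

/-- The category of coherent topologically rigid `X`-schemes. -/
abbrev SchTrig (X : Scheme.{u}) :=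
  ObjectProperty.FullSubcategory
    (fun Y : Over X => IsCoherent Y.left ∧ IsTopologicallyRigid Y.left)

/-- The inclusion of coherent topologically rigid `X`-schemes into coherent `X`-schemes. -/
def trigInclusion (X : Scheme.{u}) : SchTrig X ⥤ SchCoh X :=
  ObjectProperty.ιOfLE (fun _ h => h.1)

/-- A coherent scheme `X`, as a coherent `X`-scheme. -/
def SchCoh.self (X : Scheme.{u}) (hX : IsCoherent X) : SchCoh X := ⟨Over.mk (𝟙 X), hX⟩

/-- The category `UH_f` of factorizations `Y ⟶ X' ⟶ X` of `f` such that `X' ⟶ X` is a universal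
homeomorphism. -/
abbrev UHFactorisation {Y X : Scheme.{u}} (f : Y ⟶ X) :=
  ObjectProperty.FullSubcategory (fun F : Factorisation f => UniversalHomeo F.π)

/-- `p : W ⟶ X` is the weak normalization of `X` under `f : Y ⟶ X`: for some `s : Y ⟶ W` with
`s ≫ p = f`, the factorization `Y ⟶ W ⟶ X` is an initial object of `UH_f`. -/
def IsWeakNormalization {Y X W : Scheme.{u}} (f : Y ⟶ X) (p : W ⟶ X) : Prop :=
  ∃ (s : Y ⟶ W) (hs : s ≫ p = f) (hp : UniversalHomeo p),
    Nonempty (IsInitial (⟨⟨W, s, p, hs⟩, hp⟩ : UHFactorisation f))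

/-- The perfect closure of a field `k` (equal to `k` in characteristic zero), realized as the
largest purely inseparable subextension of an algebraic closure of `k`. -/
abbrev PerfClosure (k : Type u) [Field k] : Type u :=
  perfectClosure k (AlgebraicClosure k)

/-- The spectrum of the perfect closure of the residue field at `x`. -/
abbrev perfPoint (X : Scheme.{u}) (x : X) : Scheme.{u} :=
  Spec (CommRingCat.of (PerfClosure (X.residueField x)))

/-- The natural morphism `Spec (κ(x)^perf) ⟶ Spec κ(x) ⟶ X`. -/
def fromPerfPoint (X : Scheme.{u}) (x : X) : perfPoint X x ⟶ X :=
  Spec.map (CommRingCat.ofHom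
    (algebraMap (X.residueField x) (PerfClosure (X.residueField x)))) ≫
    X.fromSpecResidueField x

/-- The disjoint union, over the generic points `η` of the irreducible components of `X`, of the
schemes `Spec (κ(η)^perf)`. -/
def genericPerf (X : Scheme.{u}) : Scheme.{u} :=
  ∐ fun η : genericPoints X => perfPoint X η.1

/-- The natural morphism `Ξ ⟶ X`. -/
def genericPerfMap (X : Scheme.{u}) : genericPerf X ⟶ X :=
  Sigma.desc fun η : genericPoints X => fromPerfPoint X η.1

end

end TopRigid

namespace TopRigid

/-! ### Universal homeomorphisms -/

/-! A rigid scheme `Z` maps uniquely through any universal homeomorphism `X' ⟶ X`. The reduced base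
change to `Z` is an isomorphism by rigidity, which gives a lift
(`IsTopologicallyRigid.exists_lift`). Lifts are unique because `Z` is reduced and universal
homeomorphisms are separated and radicial. So a universal homeomorphism `W ⟶ X` with `W` rigid is at
once the topological rigidification and the weak normalization under any morphism from a rigid
scheme, such as `Ξ`. It remains to construct such a `W`.

Over an affine open with ring `A`, let `D` be the integral closure of `A` in the sections of `Ξ`,
and let `B ⊆ D` consist of the elements on which any two field-valued points of `D` agreeing on `A`
agree. Then `B` is integral and radicial over `A`, and `Spec B ⟶ Spec A` is surjective because `A`
embeds in `B` (`universalHomeo_toRadicialSubring`). Forming `B` commutes with localization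
(`isLocalization_radicialSubring`), so the `Spec B` glue to `W`.

For rigidity, let `V ⟶ W` be a universal homeomorphism with `V` reduced. As `Ξ` is rigid, `Ξ ⟶ X`
lifts to `V`, and the sections of `V` then map into `B`. This splits `V ⟶ W` over each chart, and a
split universal homeomorphism with reduced source is an isomorphism. -/

instance : (UniversalHomeo.{u}).IsStableUnderBaseChange :=
  inferInstanceAs (MorphismProperty.universally _).IsStableUnderBaseChange

lemma UniversalHomeo.isHomeomorph {X Y : Scheme.{u}} {f : X ⟶ Y} (hf : UniversalHomeo f) :
    IsHomeomorph f :=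
  hf _ _ _ (IsPullback.of_id_snd)

lemma UniversalHomeo.universallyInjective {X Y : Scheme.{u}} {f : X ⟶ Y} (hf : UniversalHomeo f) :
    UniversallyInjective f :=
  ⟨fun _ _ _ _ _ h => (hf _ _ _ h).injective⟩

lemma UniversalHomeo.surjective {X Y : Scheme.{u}} {f : X ⟶ Y} (hf : UniversalHomeo f) :
    Surjective f :=
  ⟨hf.isHomeomorph.surjective⟩

/-- Integral means affine and universally closed; affineness is forced by topology, since a
topological embedding with closed image is affine. -/
lemma UniversalHomeo.isIntegralHom {X Y : Scheme.{u}} {f : X ⟶ Y} (hf : UniversalHomeo f) :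
    IsIntegralHom f := by
  rw [IsIntegralHom.iff_universallyClosed_and_isAffineHom]
  refine ⟨⟨fun _ _ _ _ _ h => (hf _ _ _ h).isClosedMap⟩, ?_⟩
  have h := hf.isHomeomorph
  exact isAffineHom_of_isInducing _ h.isInducing
    (by rw [h.surjective.range_eq]; exact isClosed_univ)

lemma universalHomeo_of_isIntegralHom {X Y : Scheme.{u}} (f : X ⟶ Y) [IsIntegralHom f]
    [UniversallyInjective f] [Surjective f] : UniversalHomeo f := by
  intro X' Y' i₁ i₂ f' h
  have : IsIntegralHom f' := MorphismProperty.of_isPullback h.flip ‹_›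
  have : UniversallyInjective f' := MorphismProperty.of_isPullback h.flip ‹_›
  have : Surjective f' := MorphismProperty.of_isPullback h.flip ‹_›
  exact isHomeomorph_iff_continuous_isClosedMap_bijective.mpr
    ⟨f'.continuous, f'.isClosedMap, f'.injective, f'.surjective⟩

lemma UniversalHomeo.comp {X Y Z : Scheme.{u}} {f : X ⟶ Y} {g : Y ⟶ Z} (hf : UniversalHomeo f)
    (hg : UniversalHomeo g) : UniversalHomeo (f ≫ g) := by
  have := hf.isIntegralHom
  have := hf.universallyInjective
  have := hf.surjective
  have := hg.isIntegralHom
  have := hg.universallyInjective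
  have := hg.surjective
  have : UniversallyInjective (f ≫ g) :=
    MorphismProperty.comp_mem _ _ _ hf.universallyInjective hg.universallyInjective
  exact universalHomeo_of_isIntegralHom _

lemma universalHomeo_of_isIso {X Y : Scheme.{u}} (f : X ⟶ Y) [IsIso f] : UniversalHomeo f :=
  universalHomeo_of_isIntegralHom f

/-- Radicial morphisms are those injective on field-valued points; this ring-theoretic form is the
model for `radicialSubring`. -/
lemma universallyInjective_SpecMap_iff {A B : CommRingCat.{u}} (φ : A ⟶ B) :
    UniversallyInjective (Spec.map φ) ↔ ∀ (L : Type u) [Field L] (σ τ : B →+* L),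
      σ.comp φ.hom = τ.comp φ.hom → σ = τ := by
  refine ((tfae_universallyInjective (Spec.map φ)).out 0 1).trans (forall₂_congr
    fun L _ => ⟨fun h σ τ hστ => ?_, fun h g₁ g₂ hg => ?_⟩)
  · have : Spec.map (CommRingCat.ofHom σ) = Spec.map (CommRingCat.ofHom τ) := h (by
      simp only [← Spec.map_comp]
      congr 1
      ext1
      exact hστ)
    exact congr($(Spec.map_injective this).hom)
  · obtain ⟨σ, rfl⟩ := Spec.map_surjective g₁
    obtain ⟨τ, rfl⟩ := Spec.map_surjective g₂
    simp only [← Spec.map_comp] at hg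
    congr 1
    ext1
    exact h σ.hom τ.hom congr($(Spec.map_injective hg).hom)

/-! ### The reduced subscheme -/

instance isReduced_nilradical_subscheme (X : Scheme.{u}) : IsReduced X.nilradical.subscheme := by
  refine @IsReduced.of_openCover _ X.nilradical.subschemeCover.openCover fun U => ?_
  have : (X.nilradical.ideal U).IsRadical := by
    exact Ideal.radical_isRadical _
  have := (Ideal.isRadical_iff_quotient_reduced _).mp this
  exact (inferInstance :
    IsReduced (Spec (CommRingCat.of (Γ(X, (U : X.affineOpens).1) ⧸ X.nilradical.ideal U))))

lemma universalHomeo_nilradical_subschemeι (X : Scheme.{u}) :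
    UniversalHomeo X.nilradical.subschemeι := by
  have : Surjective X.nilradical.subschemeι :=
    ⟨Set.range_eq_univ.mp (by simp [Scheme.IdealSheafData.range_subschemeι])⟩
  exact universalHomeo_of_isIntegralHom _

/-! ### Lifting along universal homeomorphisms -/

/-- Lifts of a morphism from a reduced scheme along a universal homeomorphism are unique. -/
lemma UniversalHomeo.lift_unique {Z X X' : Scheme.{u}} [IsReduced Z] {p : X' ⟶ X}
    (hp : UniversalHomeo p) {h₁ h₂ : Z ⟶ X'} (h : h₁ ≫ p = h₂ ≫ p) : h₁ = h₂ := by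
  have := hp.isIntegralHom
  -- As `p` is separated and `Z` reduced, agreement at residue-field points is enough.
  refine ext_of_fromSpecResidueField_eq h₁ h₂ p Set.univ dense_univ (fun x _ => ?_) h
  have := ((tfae_universallyInjective p).out 0 1).mp hp.universallyInjective
  exact this (Z.residueField x) (by simp [h])

/-- Rigidity is applied to the universal homeomorphism from the reduced subscheme. -/
lemma IsTopologicallyRigid.isReduced {Z : Scheme.{u}} (hZ : IsTopologicallyRigid Z) :
    IsReduced Z := by
  have := hZ _ _ inferInstance (universalHomeo_nilradical_subschemeι Z)
  exact isReduced_of_isOpenImmersion (inv Z.nilradical.subschemeι)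

/-- Morphisms from a topologically rigid scheme lift along universal homeomorphisms. -/
lemma IsTopologicallyRigid.exists_lift {Z X X' : Scheme.{u}} (hZ : IsTopologicallyRigid Z)
    {p : X' ⟶ X} (hp : UniversalHomeo p) (g : Z ⟶ X) : ∃ h : Z ⟶ X', h ≫ p = g := by
  let q := (pullback g p).nilradical.subschemeι ≫ pullback.fst g p
  have : IsIso q := hZ _ q inferInstance ((universalHomeo_nilradical_subschemeι _).comp
    (MorphismProperty.pullback_fst g p hp))
  refine ⟨inv q ≫ (pullback g p).nilradical.subschemeι ≫ pullback.snd g p, ?_⟩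
  rw [Category.assoc, IsIso.inv_comp_eq, Category.assoc, ← pullback.condition, Category.assoc]

/-! ### Examples of topologically rigid schemes -/

/-- The reduced source is the spectrum of a field algebraic over `K`; being radicial makes it purely
inseparable, and perfectness makes it separable, so it equals `K`. -/
lemma isTopologicallyRigid_Spec (K : Type u) [Field K] [PerfectField K] :
    IsTopologicallyRigid (Spec (CommRingCat.of K)) := by
  intro Y f hY hf
  have := hf.isIntegralHom
  have : IsAffine Y := isAffine_of_isAffineHom f
  have : Subsingleton Y := hf.isHomeomorph.injective.subsingleton
  have : Nonempty Y := hf.isHomeomorph.surjective.nonempty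
  have : IsIntegral Y := (isIntegral_iff_irreducibleSpace_and_isReduced _).mpr
    ⟨⟨inferInstance⟩, inferInstance⟩
  let := (isField_of_isIntegral_of_subsingleton Y).toField
  obtain ⟨φ, hφ⟩ := Spec.map_surjective (Y.isoSpec.inv ≫ f)
  have hφ' : UniversalHomeo (Spec.map φ) := by
    rw [hφ]; exact (universalHomeo_of_isIso _).comp hf
  algebraize [φ.hom]
  have : Algebra.IsIntegral K Γ(Y, ⊤) :=
    algebraMap_isIntegral_iff.mp (IsIntegralHom.SpecMap_iff.mp hφ'.isIntegralHom)
  have : IsPurelyInseparable K Γ(Y, ⊤) := by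
    rw [isPurelyInseparable_iff_subsingleton_emb, subsingleton_iff]
    intro σ τ
    refine AlgHom.coe_ringHom_injective
      ((universallyInjective_SpecMap_iff φ).mp hφ'.universallyInjective _ _ _ ?_)
    exact σ.comp_algebraMap.trans τ.comp_algebraMap.symm
  have : Function.Bijective φ := ⟨RingHom.injective φ.hom,
    IsPurelyInseparable.surjective_algebraMap_of_isSeparable K Γ(Y, ⊤)⟩
  have : IsIso φ := (ConcreteCategory.isIso_iff_bijective φ).mpr this
  rw [← isIso_comp_left_iff Y.isoSpec.inv f, ← hφ]
  infer_instance

lemma isTopologicallyRigid_sigma {ι : Type u} (Z : ι → Scheme.{u})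
    (hZ : ∀ i, IsTopologicallyRigid (Z i)) : IsTopologicallyRigid (∐ Z) := by
  intro Y f hY hf
  rw [← MorphismProperty.isomorphisms.iff,
    IsZariskiLocalAtTarget.iff_of_openCover (P := .isomorphisms _) (sigmaOpenCover Z)]
  intro i
  have : IsReduced (pullback f ((sigmaOpenCover Z).f i)) :=
    isReduced_of_isOpenImmersion (pullback.fst f ((sigmaOpenCover Z).f i))
  exact hZ i _ _ this (MorphismProperty.pullback_snd f _ hf)

/-! ### The generic perfect points -/

lemma isTopologicallyRigid_genericPerf (X : Scheme.{u}) : IsTopologicallyRigid (genericPerf X) :=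
  isTopologicallyRigid_sigma _ fun _ => isTopologicallyRigid_Spec _

lemma fromPerfPoint_apply (X : Scheme.{u}) (x : X) (y : perfPoint X x) :
    fromPerfPoint X x y = x :=
  (Scheme.Hom.comp_apply _ _ y).trans (X.fromSpecResidueField_apply x _)

lemma genericPerfMap_sigmaMk (X : Scheme.{u}) (η : genericPoints X) (y : perfPoint X η.1) :
    genericPerfMap X (sigmaMk _ ⟨η, y⟩) = η.1 := by
  have h : Sigma.ι (fun η : genericPoints X => perfPoint X η.1) η ≫ genericPerfMap X =
    fromPerfPoint X η.1 := Sigma.ι_desc _ _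
  rw [sigmaMk_mk]
  exact congr($h y).trans (fromPerfPoint_apply X η.1 y)

lemma range_genericPerfMap (X : Scheme.{u}) : Set.range (genericPerfMap X) = genericPoints X := by
  ext x
  constructor
  · rintro ⟨y, rfl⟩
    obtain ⟨⟨η, y⟩, rfl⟩ := (sigmaMk _).surjective y
    rw [genericPerfMap_sigmaMk]
    exact η.2
  · intro hx
    exact ⟨sigmaMk _ ⟨⟨x, hx⟩, Classical.arbitrary _⟩, genericPerfMap_sigmaMk X ⟨x, hx⟩ _⟩

lemma genericPerfMap_injective (X : Scheme.{u}) : Function.Injective (genericPerfMap X) := by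
  intro y z h
  obtain ⟨⟨η, y⟩, rfl⟩ := (sigmaMk _).surjective y
  obtain ⟨⟨ξ, z⟩, rfl⟩ := (sigmaMk _).surjective z
  rw [genericPerfMap_sigmaMk, genericPerfMap_sigmaMk] at h
  obtain rfl := Subtype.ext h
  rw [Subsingleton.elim y z]

instance discreteTopology_genericPerf (X : Scheme.{u}) : DiscreteTopology (genericPerf X) := 
  (sigmaMk _).symm.isEmbedding.discreteTopology

instance isDominant_genericPerfMap (X : Scheme.{u}) : IsDominant (genericPerfMap X) := by
  rw [isDominant_iff, DenseRange, range_genericPerfMap, dense_iff_closure_eq]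
  exact genericPoints.closure

instance quasiSeparatedSpace_genericPerf (X : Scheme.{u}) :
    QuasiSeparatedSpace (genericPerf X) :=
  ⟨fun _ _ _ hU _ _ => (hU.finite_of_discrete.inter_of_left _).isCompact⟩

/-- This is where local finiteness enters: a quasi-compact open meets finitely many components, and
points of `Ξ` inject into components. Quasi-compactness is what lets integral closure in `Ξ` commute
with localization. -/
lemma quasiCompact_genericPerfMap (X : Scheme.{u})
    (hfin : LocallyFinite (fun Z : irreducibleComponents X => (Z : Set X))) :
    QuasiCompact (genericPerfMap X) := by
  refine ⟨fun U _ hU => Set.Finite.isCompact ?_⟩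
  have hmem (y : genericPerf X) : genericPerfMap X y ∈ genericPoints X :=
    range_genericPerfMap X ▸ Set.mem_range_self y
  let g : genericPerf X → irreducibleComponents X :=
    fun y => genericPoints.component ⟨genericPerfMap X y, hmem y⟩
  have hg : Function.Injective g := fun y z h =>
    genericPerfMap_injective X congr($(genericPoints.component_injective h).1)
  exact ((hfin.finite_nonempty_inter_compact hU).preimage hg.injOn).subset
    fun y hy => ⟨genericPerfMap X y, subset_closure rfl, hy⟩

/-! ### The radicial subring -/

section Algebra

variable {A D : Type u} [CommRing A] [CommRing D]

/-- For a ring homomorphism `f : A →+* D`, the subring of those elements of `D` at which any two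
homomorphisms from `D` to a field that agree on `A` agree. -/
def radicialSubring (f : A →+* D) : Subring D where
  carrier := {b | ∀ (L : Type u) [Field L] (σ τ : D →+* L), σ.comp f = τ.comp f → σ b = τ b}
  mul_mem' ha hb L _ σ τ h := by simp [ha L σ τ h, hb L σ τ h]
  add_mem' ha hb L _ σ τ h := by simp [ha L σ τ h, hb L σ τ h]
  neg_mem' ha L _ σ τ h := by simp [ha L σ τ h]
  one_mem' L _ σ τ h := by simp
  zero_mem' L _ σ τ h := by simp

lemma mem_radicialSubring (f : A →+* D) (a : A) : f a ∈ radicialSubring f :=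
  fun _ _ _ _ h => congr($h a)

/-- The structure map of the radicial subring. -/
def toRadicialSubring (f : A →+* D) : A →+* radicialSubring f :=
  f.codRestrict _ (mem_radicialSubring f)

/-- The radicial subring is functorial. -/
def radicialSubringMap {A' D' : Type u} [CommRing A'] [CommRing D'] {f : A →+* D} {f' : A' →+* D'}
    (h : A →+* A') (g : D →+* D') (comm : g.comp f = f'.comp h) :
    radicialSubring f →+* radicialSubring f' :=
  g.restrict _ _ fun x hx L _ σ τ hστ => hx L (σ.comp g) (τ.comp g) (by
    rw [RingHom.comp_assoc, comm, RingHom.comp_assoc, comm, ← RingHom.comp_assoc, hστ,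
      RingHom.comp_assoc])

/-- The content is clearing denominators: an element of the localized radicial subring must become,
after multiplication by a power of `r`, an element radicial over `A` itself. -/
lemma isLocalization_radicialSubring {A' D' : Type u} [CommRing A'] [CommRing D'] {f : A →+* D}
    {f' : A' →+* D'} [Algebra A A'] [Algebra D D']
    (comm : (algebraMap D D').comp f = f'.comp (algebraMap A A')) (r : A)
    [IsLocalization.Away r A'] [IsLocalization.Away (f r) D'] :
    letI := (radicialSubringMap _ _ comm).toAlgebra
    IsLocalization.Away (toRadicialSubring f r) (radicialSubring f') := by
  let := (radicialSubringMap _ _ comm).toAlgebra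
  have hval (x : radicialSubring f) :
    (algebraMap (radicialSubring f) (radicialSubring f') x : D') = algebraMap D D' x := rfl
  refine ⟨?_, ?_, ?_⟩
  · rintro ⟨_, n, rfl⟩
    rw [map_pow]
    refine IsUnit.pow _ ?_
    have : algebraMap (radicialSubring f) (radicialSubring f') (toRadicialSubring f r) =
        toRadicialSubring f' (algebraMap A A' r) := Subtype.ext congr($comm r)
    rw [this]
    exact (IsLocalization.Away.algebraMap_isUnit r).map _
  · intro x
    obtain ⟨⟨d, ⟨_, n, rfl⟩⟩, hd⟩ := IsLocalization.surj (Submonoid.powers (f r)) x.1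
    dsimp only at hd
    -- The extra factor `f r` settles pairs of points that kill `f r`; the other pairs extend to
    -- `D'`, where the hypothesis on `x` applies.
    have hmem : f r * d ∈ radicialSubring f := by
      intro L _ σ τ h
      by_cases h0 : σ (f r) = 0
      · have : τ (f r) = 0 := by rw [← h0]; exact congr($h r).symm
        simp [h0, this]
      · have hσ : IsUnit (σ (f r)) := .mk0 _ h0
        have hτ : IsUnit (τ (f r)) := by
          rw [show τ (f r) = σ (f r) from congr($h r).symm]; exact hσ
        have hl : (IsLocalization.Away.lift (f r) hσ).comp f' =
            (IsLocalization.Away.lift (S := D') (f r) hτ).comp f' := by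
          refine IsLocalization.ringHom_ext (Submonoid.powers r) ?_
          rw [RingHom.comp_assoc, ← comm, RingHom.comp_assoc, ← comm, ← RingHom.comp_assoc,
            ← RingHom.comp_assoc, IsLocalization.Away.lift_comp, IsLocalization.Away.lift_comp, h]
        have key := congr($(x.2 L _ _ hl) * $(show σ (f r ^ n) = τ (f r ^ n) by
          rw [map_pow, map_pow]; exact congr($h r ^ n)))
        have h1 : σ d = τ d := by
          rw [← IsLocalization.Away.lift_eq (S := D') (f r) hσ d,
            ← IsLocalization.Away.lift_eq (S := D') (f r) hτ d, ← hd, map_mul, map_mul,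
            IsLocalization.Away.lift_eq, IsLocalization.Away.lift_eq, key]
        rw [map_mul, map_mul, h1, show σ (f r) = τ (f r) from congr($h r)]
    refine ⟨⟨⟨_, hmem⟩, ⟨_, n + 1, rfl⟩⟩, Subtype.ext ?_⟩
    simp only [Subring.coe_mul, hval, map_mul, ← hd, Subring.coe_pow]
    simp only [toRadicialSubring, RingHom.codRestrict_apply, map_pow]
    ring
  · intro x y h
    obtain ⟨⟨_, n, rfl⟩, hc⟩ := (IsLocalization.eq_iff_exists (Submonoid.powers (f r)) D').mp
      congr(($h).1)
    exact ⟨⟨_, n, rfl⟩, Subtype.ext hc⟩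

/-- A homomorphism to a field extends along an injective integral homomorphism, after passing to the
algebraic closure of the field. -/
lemma exists_extension_of_isIntegral {B L : Type u} [CommRing B] [Field L] (i : B →+* D)
    (hi : i.IsIntegral) (hinj : Function.Injective i) (σ : B →+* L) :
    ∃ σ' : D →+* AlgebraicClosure L, σ'.comp i = (algebraMap _ _).comp σ := by
  algebraize [i]
  have hP : (RingHom.ker σ).IsPrime := RingHom.ker_isPrime σ
  have : FaithfulSMul B D := (faithfulSMul_iff_algebraMap_injective B D).mpr hinj
  obtain ⟨Q, hQ, hQP⟩ := Ideal.nonempty_primesOver (S := D) (RingHom.ker σ)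
  let := (RingHom.kerLift σ).toAlgebra
  let := ((algebraMap L (AlgebraicClosure L)).comp (RingHom.kerLift σ)).toAlgebra
  have : Module.IsTorsionFree (B ⧸ RingHom.ker σ) (AlgebraicClosure L) :=
    Module.isTorsionFree_iff_algebraMap_injective.mpr
      ((algebraMap L (AlgebraicClosure L)).injective.comp (RingHom.kerLift_injective σ))
  have : Module.IsTorsionFree (B ⧸ RingHom.ker σ) (D ⧸ Q) :=
    Module.isTorsionFree_iff_algebraMap_injective.mpr
      (FaithfulSMul.algebraMap_injective _ _)
  let τ : D ⧸ Q →ₐ[B ⧸ RingHom.ker σ] AlgebraicClosure L := IsAlgClosed.lift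
  refine ⟨τ.toRingHom.comp (Ideal.Quotient.mk Q), ?_⟩
  ext b
  exact τ.commutes (Ideal.Quotient.mk _ b)

/-- Both points extend to `D` with values in an algebraic closure of `L`, where the defining
condition of the subring compares them. -/
lemma radicialSubring_ext {L : Type u} [Field L] {f : A →+* D} (hf : f.IsIntegral)
    {σ τ : radicialSubring f →+* L}
    (h : σ.comp (toRadicialSubring f) = τ.comp (toRadicialSubring f)) : σ = τ := by
  have hi : (radicialSubring f).subtype.IsIntegral :=
    RingHom.IsIntegral.tower_top (toRadicialSubring f) _ hf
  obtain ⟨σ', hσ⟩ := exists_extension_of_isIntegral _ hi Subtype.val_injective σ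
  obtain ⟨τ', hτ⟩ := exists_extension_of_isIntegral _ hi Subtype.val_injective τ
  have : σ'.comp f = τ'.comp f := by
    change (σ'.comp (radicialSubring f).subtype).comp (toRadicialSubring f) =
      (τ'.comp (radicialSubring f).subtype).comp (toRadicialSubring f)
    rw [hσ, hτ, RingHom.comp_assoc, h, RingHom.comp_assoc]
  ext b
  apply (algebraMap L (AlgebraicClosure L)).injective
  exact congr($hσ b).symm.trans ((b.2 _ _ _ this).trans congr($hτ b))

lemma isIntegral_toRadicialSubring {f : A →+* D} (hf : f.IsIntegral) :
    (toRadicialSubring f).IsIntegral := by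
  exact fun x => (hf x.1).of_map (g := (radicialSubring f).subtype) Subtype.val_injective

lemma universalHomeo_toRadicialSubring {f : A →+* D} (hf : f.IsIntegral)
    (hinj : Function.Injective f) :
    UniversalHomeo (Spec.map (CommRingCat.ofHom (toRadicialSubring f))) := by
  have : IsIntegralHom (Spec.map (CommRingCat.ofHom (toRadicialSubring f))) :=
    IsIntegralHom.SpecMap_iff.mpr (isIntegral_toRadicialSubring hf)
  have : UniversallyInjective (Spec.map (CommRingCat.ofHom (toRadicialSubring f))) :=
    (universallyInjective_SpecMap_iff _).mpr fun L _ σ τ h => radicialSubring_ext hf h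
  have : Surjective (Spec.map (CommRingCat.ofHom (toRadicialSubring f))) := by
    refine ⟨fun P => ?_⟩
    algebraize [toRadicialSubring f]
    have : FaithfulSMul A (radicialSubring f) := (faithfulSMul_iff_algebraMap_injective A _).mpr
      fun x y h => hinj congr(($h).1)
    have : Algebra.IsIntegral A (radicialSubring f) :=
      algebraMap_isIntegral_iff.mp (isIntegral_toRadicialSubring hf)
    obtain ⟨P, hP⟩ : PrimeSpectrum A := P
    obtain ⟨Q, hQ, hQP⟩ := Ideal.nonempty_primesOver (S := radicialSubring f) P
    exact ⟨⟨Q, hQ⟩, PrimeSpectrum.ext hQP.over.symm⟩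
  exact universalHomeo_of_isIntegralHom _

end Algebra

/-! ### Gluing the radicial subrings -/

noncomputable section

section RadicialDiagram

open Scheme.AffineZariskiSite

variable {X : Scheme.{u}} {F : X.AffineZariskiSiteᵒᵖ ⥤ CommRingCat.{u}}
  (α : (toOpensFunctor X).op ⋙ X.presheaf ⟶ F)

/-- The radicial subrings of an algebra over the structure presheaf. -/
def radicialDiagram : X.AffineZariskiSiteᵒᵖ ⥤ CommRingCat.{u} where
  obj U := CommRingCat.of (radicialSubring (α.app U).hom)
  map {U V} i := CommRingCat.ofHom (radicialSubringMap
    (((toOpensFunctor X).op ⋙ X.presheaf).map i).hom (F.map i).hom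
    congr($(α.naturality i).hom).symm)
  map_id U := by
    ext x
    exact congr($(F.map_id U) x.1)
  map_comp i j := by
    ext x
    exact congr($(F.map_comp i j) x.1)

/-- The structure map of `radicialDiagram`. -/
def radicialDiagramMap : (toOpensFunctor X).op ⋙ X.presheaf ⟶ radicialDiagram α where
  app U := CommRingCat.ofHom (toRadicialSubring (α.app U).hom)
  naturality {U V} i := by
    ext x
    exact Subtype.ext congr($(α.naturality i) x)

variable {α}

/-- This is quasi-coherence of the radicial subrings, the condition needed for relative gluing. -/
lemma coequifibered_radicialDiagramMap (H : α.Coequifibered) :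
    (radicialDiagramMap α).Coequifibered := by
  refine coequifibered_iff_forall_isLocalizationAway.mpr fun U r => ?_
  let : Algebra Γ(X, U.1) Γ(X, X.basicOpen r) :=
    (X.presheaf.map (homOfLE (X.basicOpen_le r)).op).hom.toAlgebra
  have : IsLocalization.Away r Γ(X, X.basicOpen r) := U.2.isLocalization_basicOpen _
  let : Algebra (F.obj (.op U)) (F.obj (.op (U.basicOpen r))) :=
    (F.map (homOfLE (U.basicOpen_le r)).op).hom.toAlgebra
  have : IsLocalization.Away ((α.app (.op U)).hom r) (F.obj (.op (U.basicOpen r))) :=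
    coequifibered_iff_forall_isLocalizationAway.mp H U r
  exact isLocalization_radicialSubring (A := Γ(X, U.1)) (A' := Γ(X, X.basicOpen r))
    (f := (α.app (.op U)).hom) (f' := (α.app (.op (U.basicOpen r))).hom)
    congr($(α.naturality (homOfLE (U.basicOpen_le r)).op).hom).symm r

end RadicialDiagram

section Glued

open Scheme.AffineZariskiSite

variable {X Y : Scheme.{u}} (f : Y ⟶ X) [QuasiCompact f] [QuasiSeparated f]

/-- The gluing datum for the largest radicial subextension of the normalization of `X` in `Y`. -/
def radicialGluingData : (directedCover X).RelativeGluingData :=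
  relativeGluingData (coequifibered_radicialDiagramMap f.coequifibered_normalizationDiagramMap)

/-- The sections over an affine open of `X` of the largest radicial subextension of the
normalization of `X` in `Y`. -/
abbrev radicialSections (U : X.AffineZariskiSite) : CommRingCat.{u} :=
  (radicialDiagram ((toOpensFunctor X).op.whiskerLeft f.normalizationDiagramMap)).obj (.op U)

/-- The structure map of `radicialSections`. -/
abbrev toRadicialSections (U : X.AffineZariskiSite) : Γ(X, U.1) ⟶ radicialSections f U :=
  CommRingCat.ofHom (toRadicialSubring (f.normalizationDiagramMap.app (.op U.1)).hom)

/-- The largest radicial subextension of the normalization of `X` in `Y`. -/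
def radicialNormalization : Scheme.{u} := (radicialGluingData f).glued

/-- The structure map of `radicialNormalization`. -/
def fromRadicialNormalization : radicialNormalization f ⟶ X := (radicialGluingData f).toBase

/-- The affine open cover of `radicialNormalization`. -/
def radicialNormalizationCover : (radicialNormalization f).OpenCover := (radicialGluingData f).cover

/-- The affine charts of `radicialNormalization`. -/
def radicialNormalizationι (U : X.AffineZariskiSite) :
    Spec (radicialSections f U) ⟶ radicialNormalization f :=
  (radicialNormalizationCover f).f U

lemma radicialNormalizationι_from (U : X.AffineZariskiSite) :
    radicialNormalizationι f U ≫ fromRadicialNormalization f =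
      Spec.map (toRadicialSections f U) ≫ U.2.fromSpec :=
  ((radicialGluingData f).ι_toBase U).trans (Category.assoc _ _ _)

instance isReduced_radicialSections [IsReduced Y] (U : X.AffineZariskiSite) :
    IsReduced (Spec (radicialSections f U)) := by
  let := (f.app U.1).hom.toAlgebra
  have : _root_.IsReduced (radicialSections f U) :=
    isReduced_of_injective ((integralClosure Γ(X, U.1) Γ(Y, f ⁻¹ᵁ U.1)).val.toRingHom.comp
      (radicialSubring (f.normalizationDiagramMap.app (.op U.1)).hom).subtype)
      (Subtype.val_injective.comp Subtype.val_injective)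
  infer_instance

omit [QuasiSeparated f] in
lemma universalHomeo_toRadicialSections [IsReduced X] [IsDominant f] (U : X.AffineZariskiSite) :
    UniversalHomeo (Spec.map (toRadicialSections f U)) := by
  let := (f.app U.1).hom.toAlgebra
  refine universalHomeo_toRadicialSubring ?_ fun x y h => ?_
  · change (algebraMap Γ(X, U.1) (integralClosure Γ(X, U.1) Γ(Y, f ⁻¹ᵁ U.1))).IsIntegral
    exact algebraMap_isIntegral_iff.mpr inferInstance
  -- Dominance over a reduced base makes sections of `X` embed in those of `Y`.
  · have := IsSchemeTheoreticallyDominant.of_isDominant f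
    exact f.app_injective U.1 congr(($h).1)

lemma universalHomeo_fromRadicialNormalization [IsReduced X] [IsDominant f] :
    UniversalHomeo (fromRadicialNormalization f) := by
  have h (U : X.AffineZariskiSite) :
      UniversalHomeo (pullback.snd (fromRadicialNormalization f) ((directedCover X).f U)) := by
    refine congr(UniversalHomeo $(((radicialGluingData f).isPullback_natTrans_ι_toBase
      U).flip.isoPullback_inv_snd)).mp ?_
    exact (universalHomeo_of_isIso _).comp
      ((universalHomeo_toRadicialSections f U).comp (universalHomeo_of_isIso U.2.isoSpec.inv))
  have : IsZariskiLocalAtTarget @IsIntegralHom :=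
    (HasAffineProperty.iff.mp IsIntegralHom.hasAffineProperty).1
  have : IsIntegralHom (fromRadicialNormalization f) :=
    (IsZariskiLocalAtTarget.iff_of_openCover (P := @IsIntegralHom) (directedCover X)).mpr
      fun U => (h U).isIntegralHom
  have : UniversallyInjective (fromRadicialNormalization f) :=
    (IsZariskiLocalAtTarget.iff_of_openCover (directedCover X)).mpr
      fun U => (h U).universallyInjective
  have : Surjective (fromRadicialNormalization f) :=
    (IsZariskiLocalAtTarget.iff_of_openCover (directedCover X)).mpr fun U => (h U).surjective
  exact universalHomeo_of_isIntegralHom _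

variable {f} in
/-- If `f` factors through a universal homeomorphism to `X`, then the sections of the latter
map to `radicialSections`. -/
lemma exists_toRadicialSections_eq {V : Scheme.{u}} {v : V ⟶ X} (hv : UniversalHomeo v)
    {t : Y ⟶ V} (ht : t ≫ v = f) (U : X.AffineZariskiSite) :
    ∃ r : Γ(V, v ⁻¹ᵁ U.1) ⟶ radicialSections f U, v.app U.1 ≫ r = toRadicialSections f U := by
  subst ht
  have := hv.isIntegralHom
  let := ((t ≫ v).app U.1).hom.toAlgebra
  -- Sections of `V` are integral over those of `X`, so their pullbacks lie in the integral closure.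
  let r₁ : Γ(V, v ⁻¹ᵁ U.1) →+* integralClosure Γ(X, U.1) Γ(Y, (t ≫ v) ⁻¹ᵁ U.1) :=
    (t.app (v ⁻¹ᵁ U.1)).hom.codRestrict _ fun c => by
      have := (v.isIntegral_app U.1 U.2 c).map (t.app (v ⁻¹ᵁ U.1)).hom
      rwa [← CommRingCat.hom_comp, ← Scheme.Hom.comp_app] at this
  have hr₁ : r₁.comp (v.app U.1).hom = ((t ≫ v).normalizationDiagramMap.app (.op U.1)).hom := by
    ext a
    exact congr($((t.comp_app v U.1).symm) a)
  have hr₂ (c : Γ(V, v ⁻¹ᵁ U.1)) :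
      r₁ c ∈ radicialSubring ((t ≫ v).normalizationDiagramMap.app (.op U.1)).hom := by
    intro L _ σ τ h
    have hV := U.2.preimage v
    -- These are two `L`-points of `V` with the same image in `X`, and `v` is radicial.
    have key : Spec.map (CommRingCat.ofHom (σ.comp r₁)) ≫ hV.fromSpec =
        Spec.map (CommRingCat.ofHom (τ.comp r₁)) ≫ hV.fromSpec := by
      have hinj := ((tfae_universallyInjective v).out 0 1).mp hv.universallyInjective
      refine hinj L ?_
      dsimp only
      rw [Category.assoc, Category.assoc, ← IsAffineOpen.SpecMap_appLE_fromSpec v U.2 hV le_rfl,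
        ← Scheme.Hom.app_eq_appLE, ← Spec.map_comp_assoc, ← Spec.map_comp_assoc]
      congr 2
      ext1
      exact RingHom.ext fun a => congr(σ ($hr₁ a)).trans (congr($h a).trans congr(τ ($hr₁ a)).symm)
    rw [cancel_mono] at key
    exact congr($(Spec.map_injective key).hom c)
  refine ⟨CommRingCat.ofHom (r₁.codRestrict _ hr₂), ?_⟩
  ext a
  refine Subtype.ext ?_
  exact congr($hr₁ a)

variable {f} in
/-- If `f` factors through a universal homeomorphism to `X`, then so do the charts of
`radicialNormalization`. -/
lemma exists_radicialSections_lift {V : Scheme.{u}} {v : V ⟶ X} (hv : UniversalHomeo v)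
    {t : Y ⟶ V} (ht : t ≫ v = f) (U : X.AffineZariskiSite) :
    ∃ r : Spec (radicialSections f U) ⟶ V,
      r ≫ v = Spec.map (toRadicialSections f U) ≫ U.2.fromSpec := by
  obtain ⟨r, hr⟩ := exists_toRadicialSections_eq hv ht U
  have := hv.isIntegralHom
  refine ⟨Spec.map r ≫ (IsAffineOpen.preimage U.2 v).fromSpec, ?_⟩
  rw [← hr, Spec.map_comp, Category.assoc, Category.assoc, Scheme.Hom.app_eq_appLE,
    IsAffineOpen.SpecMap_appLE_fromSpec v U.2 _ le_rfl]

/-! ### Rigidity of the radicial normalization. -/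

/-- Both `q ≫ r` and the identity of `V` lift `q` along `q`, so they agree because `V` is reduced.
-/
lemma isIso_of_section {V T : Scheme.{u}} [IsReduced V] {q : V ⟶ T} (hq : UniversalHomeo q)
    {r : T ⟶ V} (hr : r ≫ q = 𝟙 T) : IsIso q :=
  ⟨r, hq.lift_unique (by rw [Category.assoc, hr, Category.comp_id, Category.id_comp]), hr⟩

/-- If every universal homeomorphism of a reduced scheme to `T` is locally split, then `T` is
topologically rigid. -/
lemma isTopologicallyRigid_of_exists_lift {T : Scheme.{u}} (𝒰 : T.OpenCover)
    (h𝒰 : ∀ i, IsReduced (𝒰.X i))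
    (h : ∀ (V : Scheme.{u}) (q : V ⟶ T), UniversalHomeo q → ∀ i, ∃ r, r ≫ q = 𝒰.f i) :
    IsTopologicallyRigid T := by
  intro V q hV hq
  rw [← MorphismProperty.isomorphisms.iff,
    IsZariskiLocalAtTarget.iff_of_openCover (P := .isomorphisms _) 𝒰]
  intro i
  obtain ⟨r, hr⟩ := h V q hq i
  have := h𝒰 i
  have : IsReduced (pullback q (𝒰.f i)) := isReduced_of_isOpenImmersion (pullback.fst q (𝒰.f i))
  exact isIso_of_section (V := pullback q (𝒰.f i)) (MorphismProperty.pullback_snd q _ hq)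
    (r := pullback.lift r (𝟙 _) (by simpa using hr)) (pullback.lift_snd _ _ _)

lemma isTopologicallyRigid_radicialNormalization [IsReduced X] [IsDominant f]
    (hY : IsTopologicallyRigid Y) : IsTopologicallyRigid (radicialNormalization f) := by
  have := hY.isReduced
  have hp := universalHomeo_fromRadicialNormalization f
  refine isTopologicallyRigid_of_exists_lift (radicialNormalizationCover f)
    (isReduced_radicialSections f) fun V q hq U => ?_
  obtain ⟨t, ht⟩ := hY.exists_lift (hq.comp hp) f
  obtain ⟨r, hr⟩ := exists_radicialSections_lift (hq.comp hp) ht U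
  have := isReduced_radicialSections f U
  -- The lift `r` is so far compatible only over `X`; uniqueness of lifts along the radicial
  -- normalization makes it compatible with the chart.
  exact ⟨r, hp.lift_unique (Z := Spec (radicialSections f U))
    ((Category.assoc _ _ _).trans (hr.trans (radicialNormalizationι_from f U).symm))⟩

end Glued

end

/-! ### Weak normalizations and topological rigidifications -/

variable {X Y T W : Scheme.{u}}

/-- A universal homeomorphism with topologically rigid source is a topological rigidification. -/
lemma IsTopologicallyRigid.isTopologicalRigidification {P : ObjectProperty Scheme.{u}} {p : W ⟶ X}
    (hW : IsTopologicallyRigid W) (hPW : P W) (hp : UniversalHomeo p) :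
    IsTopologicalRigidification P p where
  mem := hPW
  rigid := hW
  existsUnique_lift Z _ hZ g := by
    obtain ⟨h, hh⟩ := hZ.exists_lift hp g
    have := hZ.isReduced
    exact ⟨h, hh, fun h' hh' => hp.lift_unique (hh'.trans hh.symm)⟩

/-- A universal homeomorphism with topologically rigid source is the weak normalization under any
morphism from a topologically rigid scheme. -/
lemma IsTopologicallyRigid.isWeakNormalization {f : Y ⟶ X} {p : W ⟶ X}
    (hW : IsTopologicallyRigid W) (hY : IsTopologicallyRigid Y) (hp : UniversalHomeo p) :
    IsWeakNormalization f p := by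
  have := hW.isReduced
  have := hY.isReduced
  obtain ⟨s, hs⟩ := hY.exists_lift hp f
  refine ⟨s, hs, hp, ⟨IsInitial.ofUniqueHom (fun F => ObjectProperty.homMk ?_) fun F m => ?_⟩⟩
  · refine ⟨(hW.exists_lift F.2 p).choose, F.2.lift_unique ?_, (hW.exists_lift F.2 p).choose_spec⟩
    rw [Category.assoc, (hW.exists_lift F.2 p).choose_spec, hs, F.1.ι_π]
  · refine ObjectProperty.hom_ext _ (Factorisation.Hom.ext ?_)
    refine F.2.lift_unique (Z := W) ?_
    exact m.hom.h_π.trans (hW.exists_lift F.2 p).choose_spec.symm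

lemma IsTopologicalRigidification.exists_iso {P : ObjectProperty Scheme.{u}} {p : W ⟶ X}
    {ε : T ⟶ X} (hp : IsTopologicalRigidification P p) (hε : IsTopologicalRigidification P ε) :
    ∃ e : T ≅ W, e.hom ≫ p = ε := by
  obtain ⟨a, ha, -⟩ := hp.existsUnique_lift T hε.mem hε.rigid ε
  obtain ⟨b, hb, -⟩ := hε.existsUnique_lift W hp.mem hp.rigid p
  refine ⟨⟨a, b, ?_, ?_⟩, ha⟩
  · exact (hε.existsUnique_lift T hε.mem hε.rigid ε).unique (by simp [ha, hb]) (by simp)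
  · exact (hp.existsUnique_lift W hp.mem hp.rigid p).unique (by simp [ha, hb]) (by simp)

lemma IsWeakNormalization.universalHomeo {f : Y ⟶ X} {p : W ⟶ X} (h : IsWeakNormalization f p) :
    UniversalHomeo p := h.choose_spec.choose_spec.choose

lemma IsWeakNormalization.exists_iso {f : Y ⟶ X} {p : W ⟶ X} {ε : T ⟶ X}
    (hp : IsWeakNormalization f p) (hε : IsWeakNormalization f ε) :
    ∃ e : T ≅ W, e.hom ≫ p = ε := by
  obtain ⟨s, hs, hpu, ⟨hi⟩⟩ := hp
  obtain ⟨t, ht, hεu, ⟨hj⟩⟩ := hε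
  let e := hj.uniqueUpToIso hi
  exact ⟨⟨e.hom.hom.h, e.inv.hom.h, congr($(e.hom_inv_id).hom.h), congr($(e.inv_hom_id).hom.h)⟩,
    e.hom.hom.h_π⟩

lemma IsTopologicallyRigid.of_iso (e : T ≅ W) (hW : IsTopologicallyRigid W) :
    IsTopologicallyRigid T := by
  intro V q hV hq
  have := hW V (q ≫ e.hom) hV (hq.comp (universalHomeo_of_isIso _))
  exact IsIso.of_isIso_comp_right q e.hom

lemma isCoherent_of_universalHomeo {p : W ⟶ X} (hp : UniversalHomeo p) (hX : IsCoherent X) :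
    IsCoherent W := by
  obtain ⟨_, _⟩ := hX
  have := hp.isIntegralHom
  exact ⟨QuasiCompact.compactSpace_of_compactSpace p, quasiSeparatedSpace_of_quasiSeparated p⟩

/-- If `X` admits a universal homeomorphism from a topologically rigid scheme, then its weak
normalization under a morphism from a topologically rigid scheme is its topological
rigidification. -/
lemma isWeakNormalization_iff {P : ObjectProperty Scheme.{u}} {f : Y ⟶ X} {p : W ⟶ X}
    (hY : IsTopologicallyRigid Y) (hW : IsTopologicallyRigid W) (hp : UniversalHomeo p)
    (hP : ∀ {V : Scheme.{u}} {v : V ⟶ X}, UniversalHomeo v → P V) (ε : T ⟶ X) :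
    IsWeakNormalization f ε ↔ IsTopologicalRigidification P ε := by
  constructor
  · intro h
    obtain ⟨e, -⟩ := (hW.isWeakNormalization hY hp).exists_iso h
    exact (hW.of_iso e).isTopologicalRigidification (hP h.universalHomeo) h.universalHomeo
  · intro h
    obtain ⟨e, he⟩ := (hW.isTopologicalRigidification (hP hp) hp).exists_iso h
    refine h.rigid.isWeakNormalization hY ?_
    rw [← he]
    exact (universalHomeo_of_isIso _).comp hp

/-- The counit of a right adjoint of `trigInclusion X` is a topological rigidification. -/
lemma isTopologicalRigidification_counit (hX : IsCoherent X) {R : SchCoh X ⥤ SchTrig X}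
    (adj : trigInclusion X ⊣ R) :
    IsTopologicalRigidification IsCoherent (adj.counit.app (SchCoh.self X hX)).hom.left := by
  refine ⟨(R.obj (SchCoh.self X hX)).2.1, (R.obj (SchCoh.self X hX)).2.2, fun Z hZ hZ' g => ?_⟩
  -- Regarded as an `X`-scheme through `g`, `Z` has `g` as its map to the terminal object `X`, so
  -- the adjunction yields the required factorization.
  let Z' : SchTrig X := ⟨Over.mk g, hZ, hZ'⟩
  let u : (trigInclusion X).obj Z' ⟶ SchCoh.self X hX :=
    ObjectProperty.homMk (Over.homMk g (Category.comp_id g))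
  have hu (k : Z' ⟶ R.obj (SchCoh.self X hX)) :
      (trigInclusion X).map k ≫ adj.counit.app (SchCoh.self X hX) = u ↔
        k = adj.homEquiv _ _ u := by
    refine Iff.trans ?_ (adj.homEquiv _ _).symm_apply_eq
    exact (congrArg (· = u) (adj.homEquiv_counit _ _ k).symm).to_iff
  refine ⟨(adj.homEquiv _ _ u).hom.left, congr(($((hu _).mpr rfl)).hom.left), fun h hh => ?_⟩
  -- The counit is a morphism over `X` to the identity of `X`, so it is the structure map; a
  -- factorization of `g` through it is thus automatically a morphism over `X`.
  have hε : (R.obj (SchCoh.self X hX)).obj.hom =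
      (adj.counit.app (SchCoh.self X hX)).hom.left :=
    (Over.w (adj.counit.app (SchCoh.self X hX)).hom).symm.trans (Category.comp_id _)
  let k : Z' ⟶ R.obj (SchCoh.self X hX) :=
    ObjectProperty.homMk (Over.homMk h ((congrArg (h ≫ ·) hε).trans hh))
  exact congr(($((hu k).mp (ObjectProperty.hom_ext _ (Over.OverMorphism.ext hh)))).hom.left)

end TopRigid

theorem mainTheorem10 (X : Scheme.{u}) (hred : IsReduced X)
    (hfin : LocallyFinite (fun Z : irreducibleComponents X => (Z : Set X))) :
    -- the natural morphism is dominant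
    IsDominant (TopRigid.genericPerfMap X) ∧
    -- the weak normalization of `X` under it exists
    (∃ (W : Scheme.{u}) (p : W ⟶ X),
      TopRigid.IsWeakNormalization (TopRigid.genericPerfMap X) p) ∧
    -- it is the topological rigidification of `X`, among all schemes
    (∀ (T : Scheme.{u}) (ε : T ⟶ X),
      TopRigid.IsWeakNormalization (TopRigid.genericPerfMap X) ε ↔
        TopRigid.IsTopologicalRigidification ⊤ ε) ∧
    -- for coherent `X`, the same holds within coherent schemes, and for the literal right adjoint
    (∀ hX : TopRigid.IsCoherent X,
      (∀ (T : Scheme.{u}) (ε : T ⟶ X),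
        TopRigid.IsWeakNormalization (TopRigid.genericPerfMap X) ε ↔
          TopRigid.IsTopologicalRigidification TopRigid.IsCoherent ε) ∧
      (∀ (R : TopRigid.SchCoh X ⥤ TopRigid.SchTrig X) (adj : TopRigid.trigInclusion X ⊣ R),
        TopRigid.IsWeakNormalization (TopRigid.genericPerfMap X)
          (adj.counit.app (TopRigid.SchCoh.self X hX)).hom.left)) := by
  have := TopRigid.quasiCompact_genericPerfMap X hfin
  have hΞ := TopRigid.isTopologicallyRigid_genericPerf X
  have hW := TopRigid.isTopologicallyRigid_radicialNormalization (TopRigid.genericPerfMap X) hΞ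
  have hp := TopRigid.universalHomeo_fromRadicialNormalization (TopRigid.genericPerfMap X)
  refine ⟨inferInstance, ⟨_, _, hW.isWeakNormalization hΞ hp⟩,
    fun T ε => TopRigid.isWeakNormalization_iff hΞ hW hp (fun _ => trivial) ε, fun hX => ?_⟩
  have key (T : Scheme.{u}) (ε : T ⟶ X) :=
    TopRigid.isWeakNormalization_iff (P := TopRigid.IsCoherent)
      (f := TopRigid.genericPerfMap X) hΞ hW hp
      (fun hv => TopRigid.isCoherent_of_universalHomeo hv hX) ε
  exact ⟨key, fun R adj => (key _ _).mpr (TopRigid.isTopologicalRigidification_counit hX adj)⟩
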